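/- Let $\mathbb F\in\{\mathbb R,\mathbb C\}$, let $[a,b]\subset\mathbb R$ be a compact interval, and let $g:[a,b]\to\mathbb R$ be a derivator, that is, a nondecreasing and left-continuous function. Let $\mu_g$ be the Lebesgue–Stieltjes measure of $g$, so that $\mu_g([c,d))=g(d)-g(c)$ for $[c,d)\subset[a,b]$. For $x_0\in[a,b]$ define the $g$-monomials centered at $x_0$ recursively by $g_{x_0,0}(x)=1$ and, for $n\ge 1$ and $x\in[a,b]$, $$g_{x_0,n}(x)=\begin{cases} n\int_{[x_0,x)} g_{x_0,n-1}\,d\mu_g, & x\ge x_0,\\[2pt] -n\int_{[x,x_0)} g_{x_0,n-1}\,d\mu_g, & x<x_0.\end{cases}$$ Let $\mathrm P_g$ be the space of $g$-polynomials, that is, of finite linear combinations, with coefficients in $\mathbb F$, of $g$-monomials $g_{x_0,n}$ ($x_0\in[a,b]$, $n\ge 0$). Let $\mathrm{UC}_g([a,b])$ be the Banach space, with the supremum norm, of all uniformly $g$-continuous functions $f:[a,b]\to\mathbb F$, that is, functions such that for every $\varepsilon>0$ there is $\delta>0$ such that for all $x,y\in[a,b]$, $|g(x)-g(y)|<\delta$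 implies $|f(x)-f(y)|<\varepsilon$. (The $g$-monomials belong to this space.) If $g$ has only finitely many discontinuity points on $[a,b]$, then $\mathrm P_g$ is dense in $\mathrm{UC}_g([a,b])$. -/

import Mathlib

open Set Filter Topology MeasureTheory

noncomputable section

/-- A derivator on the compact interval `[a, b]`: a nondecreasing, left-continuous function
`g : [a, b] → ℝ`. The field `le` only says that the interval is nonempty. -/
structure Derivator (a b : ℝ) where
  toFun : Icc a b → ℝ
  le : a ≤ b
  mono : Monotone toFun
  left_continuous : ∀ x, ContinuousWithinAt toFun (Iic x) x

namespace Derivator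

variable {a b : ℝ}

instance instCoeFun : CoeFun (Derivator a b) fun _ => Icc a b → ℝ := ⟨toFun⟩

/-- The set of discontinuity points of `g` in `[a, b]`. -/
def discontinuities (g : Derivator a b) : Set (Icc a b) := {x | ¬ ContinuousAt g x}

/-! ### The Lebesgue-Stieltjes measure -/

/-- The extension of `g` to `ℝ` which is constant on `(-∞, a]` and on `[b, ∞)`. -/
def extend (g : Derivator a b) : ℝ → ℝ := IccExtend g.le g

theorem extend_mono (g : Derivator a b) : Monotone g.extend := g.mono.IccExtend g.le

theorem extend_coe (g : Derivator a b) (x : Icc a b) : g.extend x = g x :=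
  IccExtend_val g.le g x

theorem extend_left_continuous (g : Derivator a b) (x : ℝ) :
    ContinuousWithinAt g.extend (Iic x) x := by
  have h := g.left_continuous (projIcc a b g.le x)
  exact h.comp (continuous_projIcc.continuousWithinAt)
    (fun y (hy : y ≤ x) => monotone_projIcc g.le hy)

theorem leftLim_rightLim_extend (g : Derivator a b) (x : ℝ) :
    Function.leftLim (Function.rightLim g.extend) x = g.extend x := by
  apply le_antisymm
  · have hm : Monotone (Function.rightLim g.extend) := g.extend_mono.rightLim
    have h1 := hm.tendsto_leftLim x
    refine le_of_tendsto h1 ?_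
    filter_upwards [self_mem_nhdsWithin] with y hy
    exact g.extend_mono.rightLim_le hy
  · have h2 : Tendsto g.extend (𝓝[<] x) (𝓝 (g.extend x)) :=
      (g.extend_left_continuous x).mono_left (nhdsWithin_mono _ Iio_subset_Iic_self)
    have hm : Monotone (Function.rightLim g.extend) := g.extend_mono.rightLim
    refine le_of_tendsto h2 ?_
    filter_upwards [self_mem_nhdsWithin] with y hy
    exact (g.extend_mono.le_rightLim le_rfl).trans (hm.le_leftLim hy)

/-- The Lebesgue-Stieltjes measure `μ_g` on the Borel sets of `[a, b]`. It satisfies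
`μ_g [c, d) = g d - g c`, see `measure_Ico`, and gives no mass to `{b}`. -/
def measure (g : Derivator a b) : Measure (Icc a b) :=
  g.extend_mono.stieltjesFunction.measure.comap Subtype.val

theorem measure_apply (g : Derivator a b) (s : Set (Icc a b)) :
    g.measure s = g.extend_mono.stieltjesFunction.measure (Subtype.val '' s) :=
  (MeasurableEmbedding.subtype_coe measurableSet_Icc).comap_apply _ _

theorem measure_Ico (g : Derivator a b) (c d : Icc a b) :
    g.measure (Ico c d) = ENNReal.ofReal (g d - g c) := by
  have h : (Subtype.val '' (Ico c d) : Set ℝ) = Ico (c : ℝ) d := by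
    ext y
    constructor
    · rintro ⟨z, hz, rfl⟩; exact hz
    · intro hy
      exact ⟨⟨y, c.2.1.trans hy.1, hy.2.le.trans d.2.2⟩, hy, rfl⟩
  rw [measure_apply, h, StieltjesFunction.measure_Ico]
  change ENNReal.ofReal (Function.leftLim (Function.rightLim g.extend) d -
    Function.leftLim (Function.rightLim g.extend) c) = _
  rw [leftLim_rightLim_extend, leftLim_rightLim_extend, extend_coe, extend_coe]

theorem measure_singleton_right (g : Derivator a b) :
    g.measure {⟨b, g.le, le_rfl⟩} = 0 := by
  rw [measure_apply, image_singleton, StieltjesFunction.measure_singleton]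
  change ENNReal.ofReal (Function.rightLim g.extend b -
    Function.leftLim (Function.rightLim g.extend) b) = 0
  rw [leftLim_rightLim_extend, ENNReal.ofReal_eq_zero, sub_nonpos]
  have h := g.extend_mono.tendsto_rightLim b
  refine le_of_tendsto h ?_
  filter_upwards [self_mem_nhdsWithin] with y hy
  have hy' : b ≤ y := le_of_lt hy
  simp only [extend, IccExtend, Function.comp, projIcc_of_right_le g.le hy',
    projIcc_of_right_le g.le le_rfl, le_refl]

instance instIsFiniteMeasure (g : Derivator a b) : IsFiniteMeasure g.measure := by
  constructor
  have h : (univ : Set (Icc a b)) ⊆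
      Ico ⟨a, le_rfl, g.le⟩ ⟨b, g.le, le_rfl⟩ ∪ {⟨b, g.le, le_rfl⟩} := by
    intro x _
    rcases eq_or_lt_of_le x.2.2 with hx | hx
    · exact Or.inr (Subtype.ext hx)
    · exact Or.inl ⟨x.2.1, hx⟩
  refine (measure_mono h).trans_lt ((measure_union_le _ _).trans_lt ?_)
  rw [measure_Ico, measure_singleton_right, add_zero]
  exact ENNReal.ofReal_lt_top

/-! ### Monomials -/

/-- The `g`-monomial `g_{x₀,n}` of degree `n` and center `x₀`: `g_{x₀,0} = 1` and
`g_{x₀,n}(x)` is `n ∫_{[x₀,x)} g_{x₀,n-1} dμ_g` if `x ≥ x₀`, and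
`-n ∫_{[x,x₀)} g_{x₀,n-1} dμ_g` if `x < x₀`. -/
def monomial (g : Derivator a b) (x₀ : Icc a b) : ℕ → Icc a b → ℝ
  | 0 => fun _ => 1
  | n + 1 => fun x =>
      if x₀ ≤ x then (n + 1 : ℝ) * ∫ t in Ico x₀ x, g.monomial x₀ n t ∂g.measure
      else -((n + 1 : ℝ) * ∫ t in Ico x x₀, g.monomial x₀ n t ∂g.measure)

/-! ### Uniformly `g`-continuous functions -/

/-- Uniform `g`-continuity of a function on `[a, b]`. -/
def UniformlyContinuous {𝕜 : Type*} [RCLike 𝕜] (g : Derivator a b) (f : Icc a b → 𝕜) : Prop :=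
  ∀ ε > 0, ∃ δ > 0, ∀ x y : Icc a b, |g x - g y| < δ → ‖f x - f y‖ < ε

theorem UniformlyContinuous.bounded {𝕜 : Type*} [RCLike 𝕜] {g : Derivator a b}
    {f : Icc a b → 𝕜} (hf : g.UniformlyContinuous f) : BddAbove (range fun x => ‖f x‖) := by
  obtain ⟨δ, hδ, h⟩ := hf 1 one_pos
  have hb : TotallyBounded (range g) := by
    refine (totallyBounded_Icc (g ⟨a, le_rfl, g.le⟩) (g ⟨b, g.le, le_rfl⟩)).subset ?_
    rintro _ ⟨x, rfl⟩
    exact ⟨g.mono x.2.1, g.mono x.2.2⟩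
  obtain ⟨t, htr, htf, ht⟩ := totallyBounded_iff_subset.1 hb _ (Metric.dist_mem_uniformity hδ)
  have : Nonempty (Icc a b) := ⟨⟨a, le_rfl, g.le⟩⟩
  have htr' : ∀ y, y ∈ t → ∃ x, g x = y := fun y hy => htr hy
  choose! s hs using htr'
  obtain ⟨C, hC⟩ := (htf.image (fun y => ‖f (s y)‖)).bddAbove
  refine ⟨C + 1, ?_⟩
  rintro _ ⟨x, rfl⟩
  obtain ⟨y, hy, hxy⟩ := mem_iUnion₂.1 (ht (mem_range_self x))
  have h1 : ‖f x - f (s y)‖ < 1 := by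
    apply h
    rw [hs y hy]
    exact hxy
  have h2 : ‖f (s y)‖ ≤ C := hC ⟨y, hy, rfl⟩
  have h3 := norm_sub_norm_le (f x) (f (s y))
  change ‖f x‖ ≤ C + 1
  linarith

/-- The linear subspace of uniformly `g`-continuous functions in the space of all functions. -/
def ucSubmodule (g : Derivator a b) (𝕜 : Type*) [RCLike 𝕜] : Submodule 𝕜 (Icc a b → 𝕜) where
  carrier := {f | g.UniformlyContinuous f}
  zero_mem' := fun ε hε => ⟨1, one_pos, fun _ _ _ => by simpa using hε⟩
  add_mem' := by
    intro f₁ f₂ h₁ h₂ ε hε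
    obtain ⟨δ₁, hδ₁, H₁⟩ := h₁ (ε / 2) (half_pos hε)
    obtain ⟨δ₂, hδ₂, H₂⟩ := h₂ (ε / 2) (half_pos hε)
    refine ⟨min δ₁ δ₂, lt_min hδ₁ hδ₂, fun x y hxy => ?_⟩
    have e : (f₁ + f₂) x - (f₁ + f₂) y = (f₁ x - f₁ y) + (f₂ x - f₂ y) := by
      simp only [Pi.add_apply]; ring
    rw [e]
    have i₁ := H₁ x y (hxy.trans_le (min_le_left _ _))
    have i₂ := H₂ x y (hxy.trans_le (min_le_right _ _))
    linarith [norm_add_le (f₁ x - f₁ y) (f₂ x - f₂ y)]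
  smul_mem' := by
    intro c f h ε hε
    have hc : 0 < ‖c‖ + 1 := by positivity
    obtain ⟨δ, hδ, H⟩ := h (ε / (‖c‖ + 1)) (by positivity)
    refine ⟨δ, hδ, fun x y hxy => ?_⟩
    have e : (c • f) x - (c • f) y = c * (f x - f y) := by
      simp only [Pi.smul_apply, smul_eq_mul]; ring
    rw [e, norm_mul]
    have i := H x y hxy
    rw [lt_div_iff₀ hc] at i
    nlinarith [norm_nonneg (f x - f y)]

/-- The space `UC_g([a, b])` of uniformly `g`-continuous `𝕜`-valued functions, as a type of its own,
so that it carries the topology of the supremum norm and not that of pointwise convergence. -/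
def UC (g : Derivator a b) (𝕜 : Type*) [RCLike 𝕜] : Type _ := ↥(g.ucSubmodule 𝕜)

namespace UC

variable {g : Derivator a b} {𝕜 : Type*} [RCLike 𝕜]

instance instAddCommGroup : AddCommGroup (g.UC 𝕜) :=
  inferInstanceAs (AddCommGroup ↥(g.ucSubmodule 𝕜))

instance instModule : Module 𝕜 (g.UC 𝕜) := inferInstanceAs (Module 𝕜 ↥(g.ucSubmodule 𝕜))

instance instFunLikeCoe : CoeFun (g.UC 𝕜) fun _ => Icc a b → 𝕜 := ⟨fun f => f.1⟩

/-- A uniformly `g`-continuous function as an element of `UC_g([a, b])`. -/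
def mk (f : Icc a b → 𝕜) (hf : g.UniformlyContinuous f) : g.UC 𝕜 :=
  (⟨f, hf⟩ : ↥(g.ucSubmodule 𝕜))

theorem mk_apply (f : Icc a b → 𝕜) (hf : g.UniformlyContinuous f) (x : Icc a b) :
    mk f hf x = f x := rfl

/-- The supremum norm. -/
instance instNorm : Norm (g.UC 𝕜) := ⟨fun f => ⨆ x, ‖f x‖⟩

theorem norm_def (f : g.UC 𝕜) : ‖f‖ = ⨆ x, ‖f x‖ := rfl

theorem norm_coe_le (f : g.UC 𝕜) (x : Icc a b) : ‖f x‖ ≤ ‖f‖ :=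
  le_ciSup (UniformlyContinuous.bounded f.2) x

theorem norm_le_of_forall (f : g.UC 𝕜) {C : ℝ} (h : ∀ x, ‖f x‖ ≤ C) : ‖f‖ ≤ C :=
  have : Nonempty (Icc a b) := ⟨⟨a, le_rfl, g.le⟩⟩
  ciSup_le h

theorem normedSpaceCore : NormedSpace.Core 𝕜 (g.UC 𝕜) where
  norm_nonneg f := Real.iSup_nonneg fun _ => norm_nonneg _
  norm_smul c f := by
    rw [norm_def, norm_def, Real.mul_iSup_of_nonneg (norm_nonneg c)]
    exact iSup_congr fun x => norm_mul c (f x)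
  norm_triangle f₁ f₂ := norm_le_of_forall _ fun x =>
    (norm_add_le (f₁ x) (f₂ x)).trans (add_le_add (norm_coe_le f₁ x) (norm_coe_le f₂ x))
  norm_eq_zero_iff f := by
    constructor
    · intro h
      apply Subtype.ext
      funext x
      have := norm_coe_le f x
      rw [h] at this
      exact norm_le_zero_iff.1 this
    · rintro rfl
      refine le_antisymm (norm_le_of_forall _ fun x => ?_) (Real.iSup_nonneg fun _ => norm_nonneg _)
      exact (norm_zero (E := 𝕜)).le

instance instNormedAddCommGroup : NormedAddCommGroup (g.UC 𝕜) :=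
  NormedAddCommGroup.ofCore (normedSpaceCore (𝕜 := 𝕜))

instance instNormedSpace : NormedSpace 𝕜 (g.UC 𝕜) :=
  NormedSpace.ofCore (normedSpaceCore (𝕜 := 𝕜))

instance instCompleteSpace : CompleteSpace (g.UC 𝕜) := by
  refine Metric.complete_of_cauchySeq_tendsto fun u hu => ?_
  have hp : ∀ x, CauchySeq fun n => (u n) x := by
    intro x
    rw [Metric.cauchySeq_iff] at hu ⊢
    intro ε hε
    obtain ⟨N, hN⟩ := hu ε hε
    refine ⟨N, fun m hm n hn => ?_⟩
    have h := hN m hm n hn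
    rw [dist_eq_norm] at h ⊢
    exact (norm_coe_le (u m - u n) x).trans_lt h
  choose F hF using fun x => cauchySeq_tendsto_of_complete (hp x)
  have key : ∀ ε > 0, ∃ N, ∀ n ≥ N, ∀ x, ‖(u n) x - F x‖ ≤ ε := by
    intro ε hε
    obtain ⟨N, hN⟩ := Metric.cauchySeq_iff.1 hu ε hε
    refine ⟨N, fun n hn x => ?_⟩
    refine le_of_tendsto ((tendsto_const_nhds.sub (hF x)).norm) ?_
    filter_upwards [eventually_ge_atTop N] with m hm
    have h := hN n hn m hm
    rw [dist_eq_norm] at h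
    exact (norm_coe_le (u n - u m) x).trans h.le
  have hUC : g.UniformlyContinuous F := by
    intro ε hε
    obtain ⟨N, hN⟩ := key (ε / 4) (by positivity)
    obtain ⟨δ, hδ, H⟩ := (u N).2 (ε / 4) (by positivity)
    refine ⟨δ, hδ, fun x y hxy => ?_⟩
    have h1 := hN N le_rfl x
    have h2 := hN N le_rfl y
    have h3 : ‖(u N) x - (u N) y‖ < ε / 4 := H x y hxy
    have e : F x - F y =
        -((u N) x - F x) + (((u N) x - (u N) y) + ((u N) y - F y)) := by ring
    rw [e]
    have h4 := norm_add_le (-((u N) x - F x)) (((u N) x - (u N) y) + ((u N) y - F y))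
    have h5 := norm_add_le ((u N) x - (u N) y) ((u N) y - F y)
    rw [norm_neg] at h4
    linarith
  refine ⟨mk F hUC, ?_⟩
  rw [Metric.tendsto_atTop]
  intro ε hε
  obtain ⟨N, hN⟩ := key (ε / 2) (by positivity)
  refine ⟨N, fun n hn => ?_⟩
  rw [dist_eq_norm]
  exact (norm_le_of_forall _ (hN n hn)).trans_lt (by linarith)

end UC

/-! ### Monomials are uniformly `g`-continuous; polynomials -/

/-- A function which is Lipschitz with respect to `|g x - g y|` is integrable. -/
theorem integrable_of_lipschitz (g : Derivator a b) {m : Icc a b → ℝ} {K : ℝ}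
    (hK : ∀ x y, |m x - m y| ≤ K * |g x - g y|) : Integrable m g.measure := by
  have hg : Measurable g := g.mono.measurable
  have hc : ∀ x y, g x = g y → m x = m y := by
    intro x y h
    have := hK x y
    rw [h, sub_self, abs_zero, mul_zero] at this
    exact sub_eq_zero.1 (abs_nonpos_iff.1 this)
  have hmeas : Measurable m := by
    let F : range g → ℝ := fun y => m y.2.choose
    have hF : ∀ x, F ⟨g x, mem_range_self x⟩ = m x := fun x =>
      hc _ _ (mem_range_self (f := g) x).choose_spec
    have hFc : Continuous F := by
      refine (LipschitzWith.of_dist_le_mul (K := K.toNNReal) ?_).continuous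
      rintro ⟨_, x, rfl⟩ ⟨_, y, rfl⟩
      rw [hF, hF, Real.dist_eq, Subtype.dist_eq, Real.dist_eq]
      exact (hK x y).trans (mul_le_mul_of_nonneg_right (Real.le_coe_toNNReal K) (abs_nonneg _))
    have e : m = F ∘ fun x => ⟨g x, mem_range_self x⟩ := funext fun x => (hF x).symm
    rw [e]
    exact hFc.measurable.comp (hg.subtype_mk)
  have hUC : g.UniformlyContinuous m := by
    intro ε hε
    refine ⟨ε / (|K| + 1), by positivity, fun x y h => ?_⟩
    rw [lt_div_iff₀ (by positivity)] at h
    have h1 := hK x y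
    rw [Real.norm_eq_abs]
    nlinarith [abs_nonneg (g x - g y), le_abs_self K]
  obtain ⟨C, hC⟩ := hUC.bounded
  exact Integrable.of_bound hmeas.aestronglyMeasurable C
    (Eventually.of_forall fun x => hC (mem_range_self x))

theorem monomial_sub (g : Derivator a b) (x₀ : Icc a b) (n : ℕ)
    (hi : Integrable (g.monomial x₀ n) g.measure) {x y : Icc a b} (hxy : x ≤ y) :
    g.monomial x₀ (n + 1) y - g.monomial x₀ (n + 1) x =
      (n + 1 : ℝ) * ∫ t in Ico x y, g.monomial x₀ n t ∂g.measure := by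
  have add : ∀ {p q r : Icc a b}, p ≤ q → q ≤ r →
      ∫ t in Ico p r, g.monomial x₀ n t ∂g.measure =
        (∫ t in Ico p q, g.monomial x₀ n t ∂g.measure) +
          ∫ t in Ico q r, g.monomial x₀ n t ∂g.measure := by
    intro p q r hpq hqr
    rw [← Ico_union_Ico_eq_Ico hpq hqr]
    refine setIntegral_union ?_ measurableSet_Ico hi.integrableOn hi.integrableOn
    rw [Set.disjoint_left]
    intro t h1 h2
    exact absurd h1.2 (not_lt.2 h2.1)
  simp only [monomial]
  by_cases hx : x₀ ≤ x
  · rw [if_pos hx, if_pos (hx.trans hxy), add hx hxy]; ring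
  · have hx' := (not_le.1 hx).le
    by_cases hy : x₀ ≤ y
    · rw [if_neg hx, if_pos hy, add hx' hy]; ring
    · rw [if_neg hx, if_neg hy, add hxy (not_le.1 hy).le]; ring

theorem monomial_lipschitz (g : Derivator a b) (x₀ : Icc a b) (n : ℕ) :
    ∃ K, ∀ x y, |g.monomial x₀ n x - g.monomial x₀ n y| ≤ K * |g x - g y| := by
  induction n with
  | zero => exact ⟨0, fun x y => by simp [monomial]⟩
  | succ n ih =>
    obtain ⟨K, hK⟩ := ih
    have hi := g.integrable_of_lipschitz hK
    obtain ⟨C, hC⟩ : ∃ C, ∀ x, ‖g.monomial x₀ n x‖ ≤ C := by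
      refine ⟨‖g.monomial x₀ n x₀‖ + |K| *
        (g ⟨b, g.le, le_rfl⟩ - g ⟨a, le_rfl, g.le⟩), fun x => ?_⟩
      have h1 := hK x x₀
      have h2 : |g x - g x₀| ≤ g ⟨b, g.le, le_rfl⟩ - g ⟨a, le_rfl, g.le⟩ := by
        have := g.mono (show x ≤ ⟨b, g.le, le_rfl⟩ from x.2.2)
        have := g.mono (show ⟨a, le_rfl, g.le⟩ ≤ x from x.2.1)
        have := g.mono (show x₀ ≤ ⟨b, g.le, le_rfl⟩ from x₀.2.2)
        have := g.mono (show ⟨a, le_rfl, g.le⟩ ≤ x₀ from x₀.2.1)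
        rw [abs_le]; constructor <;> linarith
      have h3 := norm_sub_norm_le (g.monomial x₀ n x) (g.monomial x₀ n x₀)
      rw [Real.norm_eq_abs (_ - _)] at h3
      nlinarith [abs_nonneg (g x - g x₀), le_abs_self K, abs_nonneg K]
    have main : ∀ x y, x ≤ y → |g.monomial x₀ (n + 1) y - g.monomial x₀ (n + 1) x| ≤
        ((n + 1 : ℝ) * C) * |g y - g x| := by
      intro x y hxy
      have hg : 0 ≤ g y - g x := sub_nonneg.2 (g.mono hxy)
      rw [g.monomial_sub x₀ n hi hxy, abs_mul, abs_of_nonneg (by positivity : (0 : ℝ) ≤ n + 1),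
        mul_assoc, abs_of_nonneg hg]
      refine mul_le_mul_of_nonneg_left ?_ (by positivity)
      have := norm_setIntegral_le_of_norm_le_const (μ := g.measure) (s := Ico x y)
        (measure_lt_top _ _) (fun t _ => hC t)
      rwa [measureReal_def, measure_Ico, ENNReal.toReal_ofReal hg] at this
    refine ⟨(n + 1 : ℝ) * C, fun x y => ?_⟩
    rcases le_total x y with h | h
    · rw [abs_sub_comm, abs_sub_comm (g x)]; exact main x y h
    · exact main y x h

theorem monomial_uniformlyContinuous (g : Derivator a b) (𝕜 : Type*) [RCLike 𝕜] (x₀ : Icc a b)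
    (n : ℕ) : g.UniformlyContinuous fun x => (g.monomial x₀ n x : 𝕜) := by
  obtain ⟨K, hK⟩ := g.monomial_lipschitz x₀ n
  intro ε hε
  refine ⟨ε / (|K| + 1), by positivity, fun x y h => ?_⟩
  rw [lt_div_iff₀ (by positivity)] at h
  have h1 := hK x y
  rw [← RCLike.ofReal_sub, RCLike.norm_ofReal]
  nlinarith [abs_nonneg (g x - g y), le_abs_self K]

/-- The `g`-monomial `g_{x₀,n}` as an element of `UC_g([a, b])`. -/
def ucMonomial (g : Derivator a b) (𝕜 : Type*) [RCLike 𝕜] (x₀ : Icc a b) (n : ℕ) : g.UC 𝕜 :=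
  UC.mk (fun x => (g.monomial x₀ n x : 𝕜)) (g.monomial_uniformlyContinuous 𝕜 x₀ n)

/-- The space `P_g` of `g`-polynomials: the linear combinations, with coefficients in `𝕜`,
of `g`-monomials (of all degrees, with all centers in `[a, b]`). -/
def polynomials (g : Derivator a b) (𝕜 : Type*) [RCLike 𝕜] : Submodule 𝕜 (g.UC 𝕜) :=
  Submodule.span 𝕜 {p | ∃ (x₀ : Icc a b) (n : ℕ), p = g.ucMonomial 𝕜 x₀ n}

end Derivator

end

/-! Monomials centered at `a` suffice; divided by factorials they are the iterated primitives of
`1`. A uniformly `g`-continuous real function is `F ∘ g` with `F` continuous on `ℝ`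
(`exists_continuous_comp_eq`), so it is enough to approximate every such `F ∘ g`. This goes by
induction on the number of discontinuities. If there are none, `μ_g` has no atoms, the iterated
primitives are `(g - g a)^n / n!`, and the Weierstrass theorem applies.

Otherwise let `d` be the least discontinuity, `D` its jump, `g'` the derivator with this jump
removed and `P` the primitive with respect to `g'`. The operator `L σ = P σ + D 1_{x > d} σ`
(`lift`) sends the `n`-th iterated primitive of `g'` to the `(n+1)`-st of `g` and is bounded in the
supremum norm. With the induction hypothesis, `L σ` is approximable for every continuous function
`σ` of `g'`. Since `P` hardly sees sets of small measure, this extends to `σ` with a jump at `d`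
(`lift_ite_mem_approximable`).

Now `F ∘ g` splits into its value stopped at `d` and a tail supported on `x > d`. Applying `L` to
powers of `g - g a` cut off after `d` gives the stopped powers, hence the head
(`head_mem_approximable`). On tails `L = P + D`, and the Volterra operator `P` has iterates decaying
like `M^m / m!`, so the Neumann series for the inverse of `P + D` recovers the tail from
approximable functions (`tail_mem_approximable`). -/

/-! ### Uniform closures, and uniformly continuous functions of a function -/

/-- The functions which are uniform limits of elements of a subspace of `X → ℝ`. -/
def uniformClosure {X : Type*} (S : Submodule ℝ (X → ℝ)) : Submodule ℝ (X → ℝ) where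
  carrier := {f | ∀ ε > 0, ∃ p ∈ S, ∀ x, |f x - p x| ≤ ε}
  zero_mem' := fun ε hε => ⟨0, S.zero_mem, fun x => by simpa using hε.le⟩
  add_mem' := by
    intro f₁ f₂ h₁ h₂ ε hε
    obtain ⟨p₁, hp₁, H₁⟩ := h₁ (ε / 2) (half_pos hε)
    obtain ⟨p₂, hp₂, H₂⟩ := h₂ (ε / 2) (half_pos hε)
    refine ⟨p₁ + p₂, S.add_mem hp₁ hp₂, fun x => ?_⟩
    have e : (f₁ + f₂) x - (p₁ + p₂) x = (f₁ x - p₁ x) + (f₂ x - p₂ x) := by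
      simp only [Pi.add_apply]; ring
    rw [e]
    linarith [abs_add_le (f₁ x - p₁ x) (f₂ x - p₂ x), H₁ x, H₂ x]
  smul_mem' := by
    intro c f h ε hε
    have hc : 0 < |c| + 1 := by positivity
    obtain ⟨p, hp, H⟩ := h (ε / (|c| + 1)) (by positivity)
    refine ⟨c • p, S.smul_mem c hp, fun x => ?_⟩
    have e : (c • f) x - (c • p) x = c * (f x - p x) := by
      simp only [Pi.smul_apply, smul_eq_mul]; ring
    rw [e, abs_mul]
    have i := H x
    rw [le_div_iff₀ hc] at i
    nlinarith [abs_nonneg (f x - p x)]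

namespace uniformClosure

variable {X : Type*} {S : Submodule ℝ (X → ℝ)}

theorem subset {f : X → ℝ} (hf : f ∈ S) : f ∈ uniformClosure S :=
  fun ε hε => ⟨f, hf, fun x => by simpa using hε.le⟩

theorem of_forall_approx {f : X → ℝ}
    (h : ∀ ε > 0, ∃ q ∈ uniformClosure S, ∀ x, |f x - q x| ≤ ε) : f ∈ uniformClosure S := by
  intro ε hε
  obtain ⟨q, hq, H⟩ := h (ε / 2) (half_pos hε)
  obtain ⟨p, hp, H'⟩ := hq (ε / 2) (half_pos hε)
  refine ⟨p, hp, fun x => ?_⟩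
  linarith [abs_sub_le (f x) (q x) (p x), H x, H' x]

/-- The Weierstrass theorem, for a uniform closure which contains all powers of a function. -/
theorem comp_of_pow_mem {u : X → ℝ} {A B : ℝ} (hu : ∀ x, u x ∈ Icc A B)
    (hpow : ∀ n : ℕ, (fun x => u x ^ n) ∈ uniformClosure S) {F : ℝ → ℝ} (hF : Continuous F) :
    (fun x => F (u x)) ∈ uniformClosure S := by
  refine of_forall_approx fun ε hε => ?_
  obtain ⟨p, hp⟩ := exists_polynomial_near_of_continuousOn A B F hF.continuousOn ε hε
  refine ⟨fun x => p.eval (u x), ?_, fun x => ?_⟩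
  · have e : (fun x => p.eval (u x)) =
        ∑ i ∈ Finset.range (p.natDegree + 1), p.coeff i • fun x => u x ^ i := by
      funext x
      simp [Polynomial.eval_eq_sum_range]
    rw [e]
    exact Submodule.sum_mem _ fun i _ => Submodule.smul_mem _ _ (hpow i)
  · rw [abs_sub_comm]
    exact (hp _ (hu x)).le

end uniformClosure

/-- A uniformly continuous function of `u` is a continuous function of `u`. -/
theorem exists_continuous_comp_eq {X : Type*} {u f : X → ℝ}
    (h : ∀ ε > 0, ∃ δ > 0, ∀ x y, |u x - u y| < δ → |f x - f y| < ε) :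
    ∃ F : ℝ → ℝ, Continuous F ∧ ∀ x, f x = F (u x) := by
  have hc : ∀ x y, u x = u y → f x = f y := by
    intro x y hxy
    by_contra hne
    obtain ⟨δ, hδ, H⟩ := h |f x - f y| (abs_pos.2 (sub_ne_zero.2 hne))
    exact lt_irrefl _ (H x y (by rw [hxy, sub_self, abs_zero]; exact hδ))
  rcases isEmpty_or_nonempty X with hX | hX
  · exact ⟨0, continuous_const, fun x => (hX.false x).elim⟩
  let F₀ : ℝ → ℝ := fun v => f (Function.invFun u v)
  have hF₀ : ∀ x, F₀ (u x) = f x := fun x => hc _ _ (Function.invFun_eq ⟨x, rfl⟩)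
  -- Uniform continuity makes `F₀` Cauchy at each point of the closure of the range; the resulting
  -- extension to this closed set is then extended to `ℝ` by Tietze.
  have hlim : ∀ v ∈ closure (range u), ∃ y, Tendsto F₀ (𝓝[range u] v) (𝓝 y) := by
    intro v hv
    have hne : (𝓝[range u] v).NeBot := mem_closure_iff_nhdsWithin_neBot.1 hv
    refine cauchy_map_iff_exists_tendsto.1 (Metric.cauchy_iff.2 ⟨inferInstance, fun ε hε => ?_⟩)
    obtain ⟨δ, hδ, H⟩ := h ε hε
    refine ⟨F₀ '' (Metric.ball v (δ / 2) ∩ range u), image_mem_map ?_, ?_⟩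
    · exact inter_mem (mem_nhdsWithin_of_mem_nhds (Metric.ball_mem_nhds _ (half_pos hδ)))
        self_mem_nhdsWithin
    · rintro _ ⟨_, ⟨hx, x, rfl⟩, rfl⟩ _ ⟨_, ⟨hy, y, rfl⟩, rfl⟩
      rw [hF₀, hF₀]
      refine H x y ?_
      rw [Metric.mem_ball, Real.dist_eq] at hx hy
      have := abs_sub_le (u x) v (u y)
      rw [abs_sub_comm v] at this
      linarith
  have hcont : ContinuousOn (extendFrom (range u) F₀) (closure (range u)) :=
    continuousOn_extendFrom Subset.rfl hlim
  obtain ⟨F, hF⟩ := ContinuousMap.exists_restrict_eq isClosed_closure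
    (⟨_, hcont.domRestrict⟩ : C(closure (range u), ℝ))
  refine ⟨F, F.continuous, fun x => ?_⟩
  have hx : u x ∈ closure (range u) := subset_closure ⟨x, rfl⟩
  have h1 : F (u x) = extendFrom (range u) F₀ (u x) := DFunLike.congr_fun hF ⟨u x, hx⟩
  rw [h1]
  obtain ⟨y, hy⟩ := hlim _ hx
  rw [extendFrom_eq hx hy, ← hF₀ x]
  exact tendsto_nhds_unique (tendsto_pure_nhds F₀ (u x))
    (hy.mono_left (pure_le_nhdsWithin (mem_range_self x)))

/-! ### Integration by parts for a measure with atoms -/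

section Volterra

variable {X : Type*} [LinearOrder X] [TopologicalSpace X] [OrderTopology X]
  [SecondCountableTopology X] [MeasurableSpace X] [BorelSpace X]

/-- Integration by parts, with an atomic part in the second term. -/
theorem setIntegral_Iio_setIntegral_Iio_add (μ : Measure X) [IsFiniteMeasure μ] {h : X → ℝ}
    (hi : Integrable h μ) (x : X) :
    ∫ s in Iio x, (∫ t in Iio s, h t ∂μ) ∂μ + ∫ t in Iio x, μ.real (Iic t) * h t ∂μ =
      μ.real (Iio x) * ∫ t in Iio x, h t ∂μ := by
  set ν := μ.restrict (Iio x) with hν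
  have hiν : Integrable h ν := hi.restrict
  have hsnd : Integrable (fun p : X × X => h p.2) (ν.prod ν) := hiν.comp_snd ν
  have hm : MeasurableSet {p : X × X | p.2 < p.1} := measurableSet_lt measurable_snd measurable_fst
  have key : ∀ s ∈ Iio x, ∫ t in Iio s, h t ∂μ = ∫ t in Iio s, h t ∂ν := by
    intro s hs
    rw [hν, Measure.restrict_restrict measurableSet_Iio, inter_eq_left.2]
    exact Iio_subset_Iio (le_of_lt hs)
  have key2 : ∀ t ∈ Iio x, μ.real (Iic t) * h t = ∫ s in Iic t, h t ∂ν := by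
    intro t ht
    rw [setIntegral_const, smul_eq_mul, hν, measureReal_restrict_apply measurableSet_Iic,
      inter_eq_left.2]
    exact fun s hs => lt_of_le_of_lt hs ht
  rw [setIntegral_congr_fun measurableSet_Iio key, setIntegral_congr_fun measurableSet_Iio key2,
    ← hν]
  -- Fubini on the square over `Iio x`, cut into `t < s` and `s ≤ t`. The diagonal belongs to the
  -- second piece, which is why `Iic t` appears there.
  have e1 : ∀ s, ∫ t in Iio s, h t ∂ν =
      ∫ t, {p : X × X | p.2 < p.1}.indicator (fun p => h p.2) (s, t) ∂ν := by
    intro s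
    rw [← integral_indicator measurableSet_Iio]
    rfl
  have e2 : ∀ t, ∫ s in Iic t, h t ∂ν =
      ∫ s, {p : X × X | p.2 < p.1}ᶜ.indicator (fun p => h p.2) (s, t) ∂ν := by
    intro t
    rw [← integral_indicator measurableSet_Iic]
    congr 1
    funext s
    simp [indicator]
  simp only [e1, e2]
  rw [← integral_integral_swap (μ := ν) (ν := ν)
    (f := fun s t => {p : X × X | p.2 < p.1}ᶜ.indicator (fun p => h p.2) (s, t))
    (hsnd.indicator hm.compl), ← integral_prod _ (hsnd.indicator hm),
    ← integral_prod _ (hsnd.indicator hm.compl), ← integral_add (hsnd.indicator hm)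
    (hsnd.indicator hm.compl)]
  have e3 : ∀ p : X × X, {p : X × X | p.2 < p.1}.indicator (fun p => h p.2) p +
      {p : X × X | p.2 < p.1}ᶜ.indicator (fun p => h p.2) p = h p.2 := fun p =>
    indicator_self_add_compl_apply _ _ _
  simp only [e3]
  rw [integral_fun_snd, smul_eq_mul]
  congr 1
  simp [hν, measureReal_def]

end Volterra

/-! ### Primitives and iterated primitives with respect to `g` -/

namespace Derivator

variable {a b : ℝ}

/-- The left endpoint of the interval. -/
def left (g : Derivator a b) : Icc a b := ⟨a, le_rfl, g.le⟩

/-- The right endpoint of the interval. -/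
def right (g : Derivator a b) : Icc a b := ⟨b, g.le, le_rfl⟩

theorem left_le (g : Derivator a b) (x : Icc a b) : g.left ≤ x := x.2.1

theorem le_right (g : Derivator a b) (x : Icc a b) : x ≤ g.right := x.2.2

theorem Iio_eq_Ico_left (g : Derivator a b) (x : Icc a b) : Iio x = Ico g.left x := by
  ext t
  exact ⟨fun h => ⟨g.left_le t, h⟩, fun h => h.2⟩

theorem measureReal_Ico (g : Derivator a b) {x y : Icc a b} (h : x ≤ y) :
    g.measure.real (Ico x y) = g y - g x := by
  rw [measureReal_def, measure_Ico, ENNReal.toReal_ofReal (sub_nonneg.2 (g.mono h))]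

theorem measureReal_Iio (g : Derivator a b) (x : Icc a b) :
    g.measure.real (Iio x) = g x - g g.left := by
  rw [g.Iio_eq_Ico_left, g.measureReal_Ico (g.left_le x)]

theorem measure_Ici (g : Derivator a b) (x : Icc a b) :
    g.measure (Ici x) = ENNReal.ofReal (g g.right - g x) := by
  have e : Ici x = Ico x g.right ∪ {g.right} := by
    rw [Ico_union_right (g.le_right x)]
    ext t
    exact ⟨fun h => ⟨h, g.le_right t⟩, fun h => h.1⟩
  refine le_antisymm ?_ ?_
  · rw [e]
    refine (measure_union_le _ _).trans ?_
    rw [measure_Ico, show g.measure {g.right} = 0 from g.measure_singleton_right, add_zero]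
  · rw [← measure_Ico]
    exact measure_mono Ico_subset_Ici_self

theorem measure_singleton_of_continuousAt (g : Derivator a b) {x : Icc a b}
    (hx : ContinuousAt g x) : g.measure {x} = 0 := by
  rcases eq_or_lt_of_le (g.le_right x) with rfl | hlt
  · exact g.measure_singleton_right
  · have : (𝓝[>] x).NeBot := nhdsGT_neBot_of_exists_gt ⟨_, hlt⟩
    have h1 : Tendsto (fun y => ENNReal.ofReal (g y - g x)) (𝓝[>] x) (𝓝 0) := by
      have h0 := (hx.tendsto.mono_left (nhdsWithin_le_nhds (s := Ioi x))).sub_const (g x)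
      rw [sub_self] at h0
      rw [← ENNReal.ofReal_zero]
      exact (ENNReal.continuous_ofReal.tendsto 0).comp h0
    refine le_antisymm (ge_of_tendsto h1 ?_) zero_le
    filter_upwards [self_mem_nhdsWithin] with y hy
    rw [← measure_Ico]
    exact measure_mono (singleton_subset_iff.2 ⟨le_rfl, hy⟩)

/-- Measurable functions on `[a, b]` with bounded values. -/
def BoundedMeasurable (f : Icc a b → ℝ) : Prop := Measurable f ∧ ∃ C, ∀ x, |f x| ≤ C

namespace BoundedMeasurable

theorem integrable {f : Icc a b → ℝ} (hf : BoundedMeasurable f) (g : Derivator a b) :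
    Integrable f g.measure := by
  obtain ⟨C, hC⟩ := hf.2
  exact Integrable.of_bound hf.1.aestronglyMeasurable C (Eventually.of_forall hC)

theorem const (c : ℝ) : BoundedMeasurable fun _ : Icc a b => c :=
  ⟨measurable_const, |c|, fun _ => le_rfl⟩

theorem add {f₁ f₂ : Icc a b → ℝ} (h₁ : BoundedMeasurable f₁) (h₂ : BoundedMeasurable f₂) :
    BoundedMeasurable (f₁ + f₂) := by
  obtain ⟨C₁, hC₁⟩ := h₁.2
  obtain ⟨C₂, hC₂⟩ := h₂.2
  exact ⟨h₁.1.add h₂.1, C₁ + C₂, fun x => (abs_add_le _ _).trans (add_le_add (hC₁ x) (hC₂ x))⟩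

theorem smul {f : Icc a b → ℝ} (c : ℝ) (h : BoundedMeasurable f) : BoundedMeasurable (c • f) := by
  obtain ⟨C, hC⟩ := h.2
  refine ⟨h.1.const_smul c, |c| * C, fun x => ?_⟩
  rw [Pi.smul_apply, smul_eq_mul, abs_mul]
  exact mul_le_mul_of_nonneg_left (hC x) (abs_nonneg c)

theorem ite {f₁ f₂ : Icc a b → ℝ} (h₁ : BoundedMeasurable f₁) (h₂ : BoundedMeasurable f₂)
    (d : Icc a b) : BoundedMeasurable fun x => if x ≤ d then f₁ x else f₂ x := by
  obtain ⟨C₁, hC₁⟩ := h₁.2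
  obtain ⟨C₂, hC₂⟩ := h₂.2
  refine ⟨Measurable.ite measurableSet_Iic h₁.1 h₂.1, max C₁ C₂, fun x => ?_⟩
  dsimp only
  split_ifs
  · exact (hC₁ x).trans (le_max_left _ _)
  · exact (hC₂ x).trans (le_max_right _ _)

theorem comp (g : Derivator a b) {F : ℝ → ℝ} (hF : Continuous F) :
    BoundedMeasurable fun x => F (g x) := by
  obtain ⟨C, hC⟩ := (isCompact_Icc (a := g g.left) (b := g g.right)).exists_bound_of_continuousOn
    hF.continuousOn
  exact ⟨hF.measurable.comp g.mono.measurable, C,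
    fun x => hC _ ⟨g.mono (g.left_le x), g.mono (g.le_right x)⟩⟩

end BoundedMeasurable

/-- The primitive of `f` with respect to `μ_g` which vanishes at `a`. -/
noncomputable def primitive (g : Derivator a b) (f : Icc a b → ℝ) (x : Icc a b) : ℝ :=
  ∫ t in Iio x, f t ∂g.measure

theorem primitive_add (g : Derivator a b) {f₁ f₂ : Icc a b → ℝ} (h₁ : BoundedMeasurable f₁)
    (h₂ : BoundedMeasurable f₂) : g.primitive (f₁ + f₂) = g.primitive f₁ + g.primitive f₂ :=
  funext fun _ => integral_add (h₁.integrable g).integrableOn (h₂.integrable g).integrableOn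

theorem primitive_smul (g : Derivator a b) (c : ℝ) (f : Icc a b → ℝ) :
    g.primitive (c • f) = c • g.primitive f :=
  funext fun _ => integral_const_mul c _

theorem primitive_sub (g : Derivator a b) {f : Icc a b → ℝ} (hf : BoundedMeasurable f)
    {x y : Icc a b} (h : x ≤ y) :
    g.primitive f y - g.primitive f x = ∫ t in Ico x y, f t ∂g.measure := by
  have e : Iio y = Iio x ∪ Ico x y := (Iio_union_Ico_eq_Iio h).symm
  rw [primitive, primitive, e, setIntegral_union _ measurableSet_Ico
    (hf.integrable g).integrableOn (hf.integrable g).integrableOn, add_sub_cancel_left]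
  rw [Set.disjoint_left]
  exact fun t h1 h2 => absurd h1 (not_lt.2 h2.1)

theorem abs_primitive_le (g : Derivator a b) {f k : Icc a b → ℝ} (hk : BoundedMeasurable k)
    (h : ∀ x, |f x| ≤ k x) (x : Icc a b) : |g.primitive f x| ≤ g.primitive k x :=
  norm_integral_le_of_norm_le (f := f) (μ := g.measure.restrict (Iio x))
    (hk.integrable g).integrableOn (Eventually.of_forall h)

/-- The primitive of a bounded function is Lipschitz with respect to `g`. This yields its
measurability, and keeps the iterated primitives of a tail continuous in `g`. -/
theorem exists_primitive_eq_comp (g : Derivator a b) {f : Icc a b → ℝ}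
    (hf : BoundedMeasurable f) : ∃ F : ℝ → ℝ, Continuous F ∧ ∀ x, g.primitive f x = F (g x) := by
  obtain ⟨C, hC⟩ := hf.2
  have main : ∀ x y, x ≤ y → |g.primitive f y - g.primitive f x| ≤ C * |g y - g x| := by
    intro x y hxy
    rw [g.primitive_sub hf hxy, abs_of_nonneg (sub_nonneg.2 (g.mono hxy)),
      ← g.measureReal_Ico hxy]
    exact norm_setIntegral_le_of_norm_le_const (f := f) (μ := g.measure) (measure_lt_top _ _) (fun t _ => hC t)
  have hL : ∀ x y, |g.primitive f x - g.primitive f y| ≤ C * |g x - g y| := by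
    intro x y
    rcases le_total x y with h | h
    · rw [abs_sub_comm, abs_sub_comm (g x)]; exact main x y h
    · exact main y x h
  refine exists_continuous_comp_eq fun ε hε => ⟨ε / (|C| + 1), by positivity, fun x y h => ?_⟩
  rw [lt_div_iff₀ (by positivity)] at h
  nlinarith [abs_nonneg (g x - g y), le_abs_self C, hL x y]

theorem BoundedMeasurable.primitive {f : Icc a b → ℝ} (hf : BoundedMeasurable f)
    (g : Derivator a b) : BoundedMeasurable (g.primitive f) := by
  obtain ⟨F, hF, h⟩ := g.exists_primitive_eq_comp hf
  rw [funext h]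
  exact .comp g hF

/-- The iterated primitives of the constant function `1`, that is, the `g`-monomials centered
at `a`, divided by the factorials. -/
noncomputable def iteratedPrimitive (g : Derivator a b) : ℕ → Icc a b → ℝ
  | 0 => fun _ => 1
  | n + 1 => g.primitive (g.iteratedPrimitive n)

theorem boundedMeasurable_iteratedPrimitive (g : Derivator a b) (n : ℕ) :
    BoundedMeasurable (g.iteratedPrimitive n) := by
  induction n with
  | zero => exact .const 1
  | succ n ih => exact ih.primitive g

theorem iteratedPrimitive_nonneg (g : Derivator a b) (n : ℕ) (x : Icc a b) :
    0 ≤ g.iteratedPrimitive n x := by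
  induction n generalizing x with
  | zero => exact zero_le_one
  | succ n ih => exact integral_nonneg ih

theorem iteratedPrimitive_one (g : Derivator a b) (x : Icc a b) :
    g.iteratedPrimitive 1 x = g x - g g.left := by
  simp [iteratedPrimitive, primitive, measureReal_Iio]

theorem iteratedPrimitive_parts (g : Derivator a b) (n : ℕ) (x : Icc a b) :
    g.iteratedPrimitive (n + 2) x +
        ∫ t in Iio x, g.measure.real (Iic t) * g.iteratedPrimitive n t ∂g.measure =
      (g x - g g.left) * g.iteratedPrimitive (n + 1) x := by
  rw [← measureReal_Iio]
  exact setIntegral_Iio_setIntegral_Iio_add g.measure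
    ((g.boundedMeasurable_iteratedPrimitive n).integrable g) x

theorem boundedMeasurable_measureReal_Iic_mul (g : Derivator a b) (n : ℕ) :
    BoundedMeasurable fun t => g.measure.real (Iic t) * g.iteratedPrimitive n t := by
  have hm : Monotone fun t : Icc a b => g.measure.real (Iic t) := fun s t h =>
    measureReal_mono (Iic_subset_Iic.2 h)
  obtain ⟨C, hC⟩ := (g.boundedMeasurable_iteratedPrimitive n).2
  refine ⟨hm.measurable.mul (g.boundedMeasurable_iteratedPrimitive n).1,
    g.measure.real univ * C, fun x => ?_⟩
  rw [abs_mul, abs_of_nonneg measureReal_nonneg]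
  exact mul_le_mul (measureReal_mono (subset_univ _)) (hC x) (abs_nonneg _) measureReal_nonneg

/-- Induction through the integration by parts formula: replacing `Iio t` by `Iic t` can only add
the mass of an atom. Without atoms nothing is lost, whence the equality in
`succ_mul_iteratedPrimitive_eq`. -/
theorem succ_mul_iteratedPrimitive_le (g : Derivator a b) (n : ℕ) (x : Icc a b) :
    (n + 1) * g.iteratedPrimitive (n + 1) x ≤ (g x - g g.left) * g.iteratedPrimitive n x := by
  induction n generalizing x with
  | zero => simp [iteratedPrimitive_one, iteratedPrimitive.eq_1]
  | succ n ih =>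
    have h1 : (n + 1) * g.iteratedPrimitive (n + 2) x ≤
        ∫ t in Iio x, g.measure.real (Iic t) * g.iteratedPrimitive n t ∂g.measure := by
      have : (n + 1) * g.iteratedPrimitive (n + 2) x =
        ∫ t in Iio x, (n + 1) * g.iteratedPrimitive (n + 1) t ∂g.measure :=
        (integral_const_mul _ _).symm
      rw [this]
      refine setIntegral_mono
        (((g.boundedMeasurable_iteratedPrimitive (n + 1)).integrable g).const_mul _).integrableOn
        ((g.boundedMeasurable_measureReal_Iic_mul n).integrable g).integrableOn fun t => ?_
      refine (ih t).trans (mul_le_mul_of_nonneg_right ?_ (g.iteratedPrimitive_nonneg n t))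
      rw [← measureReal_Iio]
      exact measureReal_mono Iio_subset_Iic_self
    push_cast
    linarith [g.iteratedPrimitive_parts n x]

theorem iteratedPrimitive_le (g : Derivator a b) (n : ℕ) (x : Icc a b) :
    g.iteratedPrimitive n x ≤ (g x - g g.left) ^ n / n.factorial := by
  induction n with
  | zero => simp [iteratedPrimitive]
  | succ n ih =>
    have h1 := g.succ_mul_iteratedPrimitive_le n x
    have h2 := mul_le_mul_of_nonneg_left ih (sub_nonneg.2 (g.mono (g.left_le x)))
    rw [Nat.factorial_succ, pow_succ', Nat.cast_mul, mul_comm (((n + 1 : ℕ)) : ℝ), ← div_div,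
      le_div_iff₀ (by positivity), mul_comm, mul_div_assoc]
    push_cast
    linarith

theorem succ_mul_iteratedPrimitive_eq (g : Derivator a b) {c : Icc a b}
    (hc : ∀ t < c, g.measure {t} = 0) (n : ℕ) {x : Icc a b} (hx : x ≤ c) :
    (n + 1) * g.iteratedPrimitive (n + 1) x = (g x - g g.left) * g.iteratedPrimitive n x := by
  induction n generalizing x with
  | zero => simp [iteratedPrimitive_one, iteratedPrimitive.eq_1]
  | succ n ih =>
    have h1 : (n + 1) * g.iteratedPrimitive (n + 2) x =
        ∫ t in Iio x, g.measure.real (Iic t) * g.iteratedPrimitive n t ∂g.measure := by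
      have : (n + 1) * g.iteratedPrimitive (n + 2) x =
        ∫ t in Iio x, (n + 1) * g.iteratedPrimitive (n + 1) t ∂g.measure :=
        (integral_const_mul _ _).symm
      rw [this]
      refine setIntegral_congr_fun measurableSet_Iio fun t ht => ?_
      have htc : t < c := lt_of_lt_of_le ht hx
      have e : g.measure.real (Iic t) = g.measure.real (Iio t) := by
        refine le_antisymm ?_ (measureReal_mono Iio_subset_Iic_self)
        rw [← Iio_union_right]
        refine (measureReal_union_le _ _).trans ?_
        rw [measureReal_def _ {t}, hc t htc, ENNReal.toReal_zero, add_zero]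
      exact (ih htc.le).trans (by rw [e, measureReal_Iio])
    push_cast
    linarith [g.iteratedPrimitive_parts n x]

theorem iteratedPrimitive_eq (g : Derivator a b) {c : Icc a b}
    (hc : ∀ t < c, g.measure {t} = 0) (n : ℕ) {x : Icc a b} (hx : x ≤ c) :
    g.iteratedPrimitive n x = (g x - g g.left) ^ n / n.factorial := by
  induction n with
  | zero => simp [iteratedPrimitive]
  | succ n ih =>
    have h := g.succ_mul_iteratedPrimitive_eq hc n hx
    rw [ih] at h
    rw [Nat.factorial_succ, Nat.cast_mul, eq_div_iff (by positivity), pow_succ']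
    have hf : (n.factorial : ℝ) ≠ 0 := by positivity
    field_simp at h
    push_cast
    linarith

end Derivator

/-! ### Removing a jump, and the operator `lift` -/

namespace Derivator

variable {a b : ℝ}

/-- The derivator `g` jumps by `D > 0` at the point `d`. -/
structure IsJump (g : Derivator a b) (d : Icc a b) (D : ℝ) : Prop where
  pos : 0 < D
  lt_right : d < g.right
  tendsto : Tendsto g (𝓝[>] d) (𝓝 (g d + D))

theorem continuousAt_right (g : Derivator a b) : ContinuousAt g g.right := by
  have h := g.left_continuous g.right
  have e : Iic g.right = univ := eq_univ_of_forall g.le_right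
  rwa [e, continuousWithinAt_univ] at h

/-- Left continuity leaves only the right limit to fail; it exists by monotonicity, and if it were
equal to `g d` then `g` would be continuous at `d`. -/
theorem exists_isJump (g : Derivator a b) {d : Icc a b} (hd : ¬ ContinuousAt g d) :
    ∃ D, g.IsJump d D := by
  have hlt : d < g.right := by
    refine lt_of_le_of_ne (g.le_right d) ?_
    rintro rfl
    exact hd g.continuousAt_right
  have hlim := g.mono.tendsto_nhdsGT d
  set L := sInf (g '' Ioi d)
  have hL : g d ≤ L := by
    refine le_csInf ⟨_, mem_image_of_mem g hlt⟩ ?_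
    rintro _ ⟨y, hy, rfl⟩
    exact g.mono (le_of_lt hy)
  refine ⟨L - g d, sub_pos.2 (lt_of_le_of_ne hL fun h => hd ?_), hlt, by
    rwa [add_sub_cancel]⟩
  refine continuousAt_iff_continuous_left'_right'.2
    ⟨(g.left_continuous d).mono Iio_subset_Iic_self, ?_⟩
  rw [ContinuousWithinAt, h]
  exact hlim

namespace IsJump

variable {g : Derivator a b} {d : Icc a b} {D : ℝ}

theorem neBot (h : g.IsJump d D) : (𝓝[>] d).NeBot := nhdsGT_neBot_of_exists_gt ⟨_, h.lt_right⟩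

theorem add_le (h : g.IsJump d D) {y : Icc a b} (hy : d < y) : g d + D ≤ g y := by
  have := h.neBot
  refine le_of_tendsto h.tendsto ?_
  filter_upwards [Ioo_mem_nhdsGT hy] with z hz
  exact g.mono hz.2.le

theorem not_continuousAt (h : g.IsJump d D) : ¬ ContinuousAt g d := by
  intro hc
  have := h.neBot
  have := tendsto_nhds_unique h.tendsto (hc.tendsto.mono_left nhdsWithin_le_nhds)
  linarith [h.pos]

/-- The derivator `g` with the jump at `d` removed. -/
noncomputable def remove (h : g.IsJump d D) : Derivator a b where
  toFun x := if x ≤ d then g x else g x - D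
  le := g.le
  mono := by
    intro x y hxy
    dsimp only
    split_ifs with hx hy hy
    · exact g.mono hxy
    · linarith [g.mono hx, h.add_le (not_le.1 hy)]
    · exact absurd (hxy.trans hy) hx
    · linarith [g.mono hxy]
  left_continuous x := by
    by_cases hx : x ≤ d
    · refine (g.left_continuous x).congr (fun y hy => if_pos (le_trans hy hx)) (if_pos hx)
    · have : ContinuousWithinAt (fun y => g y - D) (Iic x) x :=
        (g.left_continuous x).sub continuousWithinAt_const
      refine this.congr_of_eventuallyEq ?_ (if_neg hx)
      filter_upwards [mem_nhdsWithin_of_mem_nhds (Ioi_mem_nhds (not_le.1 hx))] with y hy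
      exact if_neg (not_le.2 hy)

variable (h : g.IsJump d D)
include h

theorem remove_of_le {x : Icc a b} (hx : x ≤ d) : h.remove x = g x := if_pos hx

theorem remove_of_lt {x : Icc a b} (hx : d < x) : h.remove x = g x - D := if_neg (not_le.2 hx)

theorem left_remove : h.remove.left = g.left := rfl

theorem remove_left : h.remove g.left = g g.left := h.remove_of_le (g.left_le d)

theorem continuousAt_remove : ContinuousAt h.remove d := by
  refine continuousAt_iff_continuous_left'_right'.2
    ⟨(h.remove.left_continuous d).mono Iio_subset_Iic_self, ?_⟩
  have h1 := h.tendsto.sub_const D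
  rw [add_sub_cancel_right] at h1
  rw [ContinuousWithinAt, h.remove_of_le le_rfl]
  refine h1.congr' ?_
  filter_upwards [self_mem_nhdsWithin] with y hy
  exact (h.remove_of_lt hy).symm

theorem discontinuities_remove_subset : h.remove.discontinuities ⊆ g.discontinuities \ {d} := by
  intro x hx
  refine ⟨fun hc => hx ?_, ?_⟩
  · have hxd : x ≠ d := by
      rintro rfl
      exact h.not_continuousAt hc
    rcases lt_or_gt_of_ne hxd with hlt | hlt
    · refine hc.congr ?_
      filter_upwards [Iio_mem_nhds hlt] with y hy
      exact (h.remove_of_le (le_of_lt hy)).symm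
    · have : ContinuousAt (fun y => g y - D) x := hc.sub continuousAt_const
      refine this.congr ?_
      filter_upwards [Ioi_mem_nhds hlt] with y hy
      exact (h.remove_of_lt hy).symm
  · rintro rfl
    exact hx h.continuousAt_remove

theorem measure_remove_singleton : h.remove.measure {d} = 0 :=
  h.remove.measure_singleton_of_continuousAt h.continuousAt_remove

/-- Finite measures on `[a, b]` are determined by the rays `Ici x`, whose masses are explicit on
both sides. -/
theorem measure_eq : g.measure = h.remove.measure + ENNReal.ofReal D • Measure.dirac d := by
  refine Measure.ext_of_Ici _ _ fun x => ?_
  rw [Measure.add_apply, Measure.smul_apply, Measure.dirac_apply' _ measurableSet_Ici,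
    measure_Ici, measure_Ici, smul_eq_mul]
  have e : h.remove h.remove.right = g g.right - D := h.remove_of_lt h.lt_right
  rw [e]
  by_cases hx : x ≤ d
  · rw [indicator_of_mem (mem_Ici.2 hx), Pi.one_apply, mul_one, h.remove_of_le hx,
      ← ENNReal.ofReal_add _ h.pos.le]
    · congr 1; ring
    · linarith [h.add_le h.lt_right, g.mono hx]
  · rw [indicator_of_notMem (by simpa using hx), mul_zero, add_zero,
      h.remove_of_lt (not_le.1 hx), sub_sub_sub_cancel_right]

theorem primitive_eq {σ : Icc a b → ℝ} (hσ : BoundedMeasurable σ) (x : Icc a b) :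
    g.primitive σ x = h.remove.primitive σ x + if x ≤ d then 0 else D * σ d := by
  have hdirac : Integrable σ (ENNReal.ofReal D • Measure.dirac d) :=
    (integrable_dirac (by simp)).smul_measure ENNReal.ofReal_ne_top
  rw [primitive, h.measure_eq, Measure.restrict_add, integral_add_measure
    (hσ.integrable _).integrableOn hdirac.integrableOn, Measure.restrict_smul,
    integral_smul_measure, setIntegral_dirac, ENNReal.toReal_ofReal h.pos.le, primitive]
  congr 1
  by_cases hx : x ≤ d
  · rw [if_pos hx, if_neg (by simpa using hx), smul_zero]
  · rw [if_neg hx, if_pos (by simpa using hx), smul_eq_mul]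

/-- The point `d` lies in `Ico d x` but not in the tail; this is harmless because the reduced
measure has no atom there. -/
theorem primitive_remove_tail {σ : Icc a b → ℝ} (hσ : BoundedMeasurable σ) (x : Icc a b) :
    h.remove.primitive (fun t => if t ≤ d then 0 else σ t) x =
      if x ≤ d then 0 else h.remove.primitive σ x - h.remove.primitive σ d := by
  have h0 : ∀ x ≤ d, h.remove.primitive (fun t => if t ≤ d then 0 else σ t) x = 0 := by
    intro x hx
    exact setIntegral_eq_zero_of_forall_eq_zero fun t ht =>
      if_pos ((le_of_lt ht).trans hx)
  split_ifs with hx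
  · exact h0 x hx
  · have hdx := (not_le.1 hx).le
    have h1 := h.remove.primitive_sub (BoundedMeasurable.ite (.const 0) hσ d) hdx
    rw [h0 d le_rfl, sub_zero] at h1
    rw [h1, h.remove.primitive_sub hσ hdx]
    refine setIntegral_congr_ae measurableSet_Ico ?_
    have : ∀ᵐ t ∂h.remove.measure, t ≠ d := compl_mem_ae_iff.2 h.measure_remove_singleton
    filter_upwards [this] with t ht htI
    exact if_neg (not_le.2 (lt_of_le_of_ne htI.1 ht.symm))

theorem primitive_remove_head {σ : Icc a b → ℝ} (hσ : BoundedMeasurable σ) (x : Icc a b) :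
    h.remove.primitive (fun t => if t ≤ d then σ t else 0) x =
      h.remove.primitive σ (min x d) := by
  have e : σ = (fun t => if t ≤ d then σ t else 0) + fun t => if t ≤ d then 0 else σ t := by
    funext t
    simp only [Pi.add_apply]
    split_ifs <;> simp
  have h1 := congrFun (h.remove.primitive_add (hσ.ite (.const 0) d)
    (BoundedMeasurable.ite (.const 0) hσ d)) x
  rw [← e, Pi.add_apply, h.primitive_remove_tail hσ] at h1
  split_ifs at h1 with hx
  · rw [min_eq_left hx]; linarith
  · rw [min_eq_right (not_le.1 hx).le]; linarith

/-- The operator which turns divided monomials of the derivator without the jump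
into divided monomials of `g`, of a degree higher by one. -/
noncomputable def lift (σ : Icc a b → ℝ) : Icc a b → ℝ :=
  h.remove.primitive σ + D • fun x => if x ≤ d then 0 else σ x

theorem lift_add {σ τ : Icc a b → ℝ} (hσ : BoundedMeasurable σ) (hτ : BoundedMeasurable τ) :
    h.lift (σ + τ) = h.lift σ + h.lift τ := by
  funext x
  simp only [lift, h.remove.primitive_add hσ hτ, Pi.add_apply, Pi.smul_apply, smul_eq_mul]
  split_ifs <;> ring

theorem lift_smul (c : ℝ) (σ : Icc a b → ℝ) : h.lift (c • σ) = c • h.lift σ := by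
  funext x
  simp only [lift, h.remove.primitive_smul, Pi.add_apply, Pi.smul_apply, smul_eq_mul]
  split_ifs <;> ring

/-- Integrating the tail term gives `D (P σ x - P σ d)` for `x > d`, where `P` is the primitive
without the jump. The atom of `g` at `d` contributes `D P σ d`, as the tail term vanishes at `d`
itself, and the two values at `d` cancel. -/
theorem primitive_lift {σ : Icc a b → ℝ} (hσ : BoundedMeasurable σ) :
    g.primitive (h.lift σ) = h.lift (h.remove.primitive σ) := by
  have ht := BoundedMeasurable.ite (.const 0) hσ d
  have hp := hσ.primitive h.remove
  funext x
  rw [lift, h.primitive_eq (hp.add (ht.smul D)), h.remove.primitive_add hp (ht.smul D),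
    h.remove.primitive_smul]
  simp only [lift, Pi.add_apply, Pi.smul_apply, smul_eq_mul, h.primitive_remove_tail hσ, le_rfl,
    if_true]
  split_ifs <;> ring

theorem lift_iteratedPrimitive (n : ℕ) :
    h.lift (h.remove.iteratedPrimitive n) = g.iteratedPrimitive (n + 1) := by
  induction n with
  | zero =>
    funext x
    simp only [iteratedPrimitive]
    rw [h.primitive_eq (.const 1)]
    simp [lift]
  | succ n ih =>
    rw [iteratedPrimitive, ← h.primitive_lift (h.remove.boundedMeasurable_iteratedPrimitive n), ih]
    rfl

end IsJump

end Derivator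

/-! ### Approximation of continuous functions of `g` -/

namespace Derivator

variable {a b : ℝ}

/-- The real functions which are uniform limits of `g`-polynomials centered at `a`. -/
noncomputable abbrev approximable (g : Derivator a b) : Submodule ℝ (Icc a b → ℝ) :=
  uniformClosure (Submodule.span ℝ (range g.iteratedPrimitive))

theorem iteratedPrimitive_mem_approximable (g : Derivator a b) (n : ℕ) :
    g.iteratedPrimitive n ∈ g.approximable :=
  uniformClosure.subset (Submodule.subset_span (mem_range_self n))

/-- The Weierstrass theorem for `g ∘ r`: if the divided powers of `g (r x) - g a` are approximable,
then so are all continuous functions of `g (r x)`. -/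
theorem comp_mem_approximable (g : Derivator a b) (r : Icc a b → Icc a b)
    (hpow : ∀ n : ℕ, (fun x => (g (r x) - g g.left) ^ n / n.factorial) ∈ g.approximable)
    {F : ℝ → ℝ} (hF : Continuous F) : (fun x => F (g (r x))) ∈ g.approximable := by
  have h := uniformClosure.comp_of_pow_mem (u := fun x => g (r x) - g g.left)
    (A := 0) (B := g g.right - g g.left) (S := Submodule.span ℝ (range g.iteratedPrimitive))
    (fun x => ⟨sub_nonneg.2 (g.mono (g.left_le _)), sub_le_sub_right (g.mono (g.le_right _)) _⟩)
    (fun n => ?_) (F := fun v => F (v + g g.left)) (by fun_prop)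
  · simpa only [sub_add_cancel] using h
  · have e : (fun x => (g (r x) - g g.left) ^ n) =
        (n.factorial : ℝ) • fun x => (g (r x) - g g.left) ^ n / n.factorial := by
      funext x
      rw [Pi.smul_apply, smul_eq_mul, mul_div_cancel₀ _ (by positivity)]
    rw [e]
    exact Submodule.smul_mem _ _ (hpow n)

theorem comp_mem_approximable_of_continuous (g : Derivator a b) (hg : g.discontinuities = ∅)
    {F : ℝ → ℝ} (hF : Continuous F) : (fun x => F (g x)) ∈ g.approximable := by
  refine g.comp_mem_approximable id (fun n => ?_) hF
  convert g.iteratedPrimitive_mem_approximable n using 1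
  funext x
  refine (g.iteratedPrimitive_eq (c := g.right) (fun t _ => ?_) n (g.le_right x)).symm
  refine g.measure_singleton_of_continuousAt ?_
  by_contra hc
  exact (hg ▸ (show t ∈ g.discontinuities from hc) : t ∈ (∅ : Set (Icc a b)))

/-- The intermediate value theorem for a derivator which is continuous to the left of `d`. -/
theorem exists_le_sub_le (g : Derivator a b) {d : Icc a b} (hcont : ∀ t < d, ContinuousAt g t)
    (η : ℝ) (hη : 0 < η) : ∃ t ≤ d, g d - g t ≤ η ∧ ∀ x < t, g x ≤ g d - η := by
  -- If the level `g d - η` is not above `g a`, the left endpoint serves and the last condition is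
  -- vacuous; otherwise the level is attained.
  by_cases hl : g d - η ≤ g g.left
  · exact ⟨g.left, g.left_le d, by linarith, fun x hx => absurd hx (not_lt.2 (g.left_le x))⟩
  · have hIic : ContinuousOn g (Iic d) := by
      intro x hx
      rcases eq_or_lt_of_le (mem_Iic.1 hx) with rfl | hlt
      · exact g.left_continuous x
      · exact (hcont x hlt).continuousWithinAt
    have hext : ContinuousOn g.extend (Icc a d) := by
      refine hIic.comp continuous_projIcc.continuousOn fun s hs => ?_
      have := monotone_projIcc g.le hs.2
      rwa [projIcc_val] at this
    have ha : g.extend a = g g.left := g.extend_coe g.left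
    obtain ⟨s, hs, hgs⟩ := intermediate_value_Icc d.2.1 hext
      (show g d - η ∈ Icc (g.extend a) (g.extend d) by
        rw [ha, g.extend_coe]
        exact ⟨(not_le.1 hl).le, by linarith⟩)
    have hgt : g ⟨s, hs.1, hs.2.trans d.2.2⟩ = g d - η := by
      rw [← hgs]
      exact (g.extend_coe ⟨s, hs.1, hs.2.trans d.2.2⟩).symm
    exact ⟨⟨s, hs.1, hs.2.trans d.2.2⟩, hs.2, by linarith, fun x hx => hgt ▸ g.mono hx.le⟩

theorem primitive_const (g : Derivator a b) (c : ℝ) (x : Icc a b) :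
    g.primitive (fun _ => c) x = (g x - g g.left) * c := by
  rw [primitive, setIntegral_const, measureReal_Iio, smul_eq_mul]

namespace IsJump

variable {g : Derivator a b} {d : Icc a b} {D : ℝ} (h : g.IsJump d D)
include h

theorem abs_lift_le {σ : Icc a b → ℝ} {ε : ℝ} (hσ : ∀ x, |σ x| ≤ ε) (x : Icc a b) :
    |h.lift σ x| ≤ (h.remove h.remove.right - h.remove h.remove.left + D) * ε := by
  have hε : 0 ≤ ε := (abs_nonneg _).trans (hσ x)
  have h1 := h.remove.abs_primitive_le (.const ε) hσ x
  rw [primitive_const] at h1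
  have h2 := mul_le_mul_of_nonneg_right (sub_le_sub_right
    (h.remove.mono (h.remove.le_right x)) (h.remove h.remove.left)) hε
  have h3 : |D * if x ≤ d then 0 else σ x| ≤ D * ε := by
    rw [abs_mul, abs_of_pos h.pos]
    refine mul_le_mul_of_nonneg_left ?_ h.pos.le
    split_ifs
    · rwa [abs_zero]
    · exact hσ x
  have h4 := abs_add_le (h.remove.primitive σ x) (D * if x ≤ d then 0 else σ x)
  have e : h.lift σ x = h.remove.primitive σ x + D * if x ≤ d then 0 else σ x := rfl
  rw [e]
  linarith

/-- By `abs_lift_le`, `lift` is bounded in the supremum norm by the reduced total mass plus `D`, so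
it carries uniform closures to uniform closures. -/
theorem lift_mem_approximable {ρ : Icc a b → ℝ} (hρ : BoundedMeasurable ρ)
    (hm : ρ ∈ h.remove.approximable) : h.lift ρ ∈ g.approximable := by
  refine uniformClosure.of_forall_approx fun ε hε => ?_
  set M := h.remove h.remove.right - h.remove h.remove.left + D with hM
  have hMpos : 0 < M := add_pos_of_nonneg_of_pos
    (sub_nonneg.2 (h.remove.mono (h.remove.left_le _))) h.pos
  obtain ⟨p, hp, H⟩ := hm (ε / M) (div_pos hε hMpos)
  have hp' : BoundedMeasurable p ∧ h.lift p ∈ g.approximable := by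
    clear H
    induction hp using Submodule.span_induction with
    | mem x hx =>
      obtain ⟨n, rfl⟩ := hx
      refine ⟨h.remove.boundedMeasurable_iteratedPrimitive n, ?_⟩
      rw [h.lift_iteratedPrimitive]
      exact g.iteratedPrimitive_mem_approximable _
    | zero =>
      refine ⟨.const 0, ?_⟩
      have := h.lift_smul 0 0
      rw [zero_smul, zero_smul] at this
      rw [this]
      exact Submodule.zero_mem _
    | add x y _ _ hx hy =>
      rw [h.lift_add hx.1 hy.1]
      exact ⟨hx.1.add hy.1, Submodule.add_mem _ hx.2 hy.2⟩
    | smul c x _ hx =>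
      rw [h.lift_smul]
      exact ⟨hx.1.smul c, Submodule.smul_mem _ c hx.2⟩
  refine ⟨h.lift p, hp'.2, fun x => ?_⟩
  have e : h.lift ρ x - h.lift p x = h.lift (ρ + (-1 : ℝ) • p) x := by
    rw [h.lift_add hρ (hp'.1.smul _), h.lift_smul]
    simp only [Pi.add_apply, Pi.smul_apply, smul_eq_mul]
    ring
  rw [e]
  refine (h.abs_lift_le (ε := ε / M) (fun y => ?_) x).trans_eq (mul_div_cancel₀ _ hMpos.ne')
  simpa [← sub_eq_add_neg] using H y

/-- Functions with a jump at `d` can be used in `lift`: they are approximated, except on a set of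
small measure, by functions which are continuous there. -/
theorem lift_ite_mem_approximable (hcont : ∀ t < d, ContinuousAt g t)
    (ih : ∀ F : ℝ → ℝ, Continuous F → (fun x => F (h.remove x)) ∈ h.remove.approximable)
    {F₁ F₂ : ℝ → ℝ} (hF₁ : Continuous F₁) (hF₂ : Continuous F₂) :
    h.lift (fun x => if x ≤ d then F₁ (g x) else F₂ (g x)) ∈ g.approximable := by
  refine uniformClosure.of_forall_approx fun ε hε => ?_
  set σ : Icc a b → ℝ := fun x => if x ≤ d then F₁ (g x) else F₂ (g x) with hσdef
  have hσ : BoundedMeasurable σ := (BoundedMeasurable.comp g hF₁).ite (.comp g hF₂) d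
  -- The mismatch at `d` in the variable of `h.remove`. A ramp of height `c` and width `η` to the
  -- left of `g d` makes up for it; the resulting error is at most `η * |c|`.
  set c := F₂ (g d + D) - F₁ (g d) with hc
  set η := ε / (|c| + 1) with hη
  have hηpos : 0 < η := by positivity
  obtain ⟨t, htd, ht, htx⟩ := g.exists_le_sub_le hcont η hηpos
  set F : ℝ → ℝ := fun u =>
    if u ≤ g d then F₁ u + c * max 0 (1 - (g d - u) / η) else F₂ (u + D) with hFdef
  have hF : Continuous F := by
    refine Continuous.if_le (by fun_prop) (by fun_prop) continuous_id continuous_const ?_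
    rintro u rfl
    simp [hc]
  set ρ : Icc a b → ℝ := fun x => F (h.remove x) with hρdef
  have hρ : BoundedMeasurable ρ := .comp h.remove hF
  refine ⟨h.lift ρ, h.lift_mem_approximable hρ (ih F hF), fun x => ?_⟩
  have hhead : ∀ x ≤ d, ρ x = σ x + c * max 0 (1 - (g d - g x) / η) := by
    intro x hx
    simp only [hρdef, hσdef, hFdef, h.remove_of_le hx, if_pos hx, if_pos (g.mono hx)]
  have htail : ∀ x, d < x → ρ x = σ x := by
    intro x hx
    have h1 := h.add_le hx
    simp only [hρdef, hσdef, hFdef, h.remove_of_lt hx, if_neg (not_le.2 hx), sub_add_cancel]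
    -- If `g` is constant just after `d`, the reduced derivator may still equal `g d` at `x > d`.
    -- The first branch of `F` is then used, and the ramp gives it the value of `F₂`.
    split_ifs with h2
    · have e : g x = g d + D := by linarith
      simp [e, hc]
    · rfl
  have hbound : ∀ x, |(σ + (-1 : ℝ) • ρ) x| ≤
      (fun x => if x ≤ d then (Ici t).indicator (fun _ => |c|) x else 0) x := by
    intro x
    simp only [Pi.add_apply, Pi.smul_apply, smul_eq_mul]
    split_ifs with hx
    · rw [hhead x hx]
      have e : σ x + -1 * (σ x + c * max 0 (1 - (g d - g x) / η)) =
        -(c * max 0 (1 - (g d - g x) / η)) := by ring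
      rw [e, abs_neg, abs_mul, abs_of_nonneg (le_max_left (0 : ℝ) _)]
      by_cases hxt : t ≤ x
      · rw [indicator_of_mem (mem_Ici.2 hxt)]
        refine mul_le_of_le_one_right (abs_nonneg c) (max_le zero_le_one ?_)
        have : 0 ≤ (g d - g x) / η := div_nonneg (sub_nonneg.2 (g.mono hx)) hηpos.le
        linarith
      · rw [indicator_of_notMem (by simpa using hxt)]
        have h1 : 1 ≤ (g d - g x) / η := by
          rw [one_le_div hηpos]
          linarith [htx x (not_le.1 hxt)]
        rw [max_eq_left (by linarith), mul_zero]
    · rw [htail x (not_le.1 hx)]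
      simp
  have hk : BoundedMeasurable ((Ici t).indicator fun _ => |c|) := by
    refine ⟨measurable_const.indicator measurableSet_Ici, |c|, fun x => ?_⟩
    by_cases hx : x ∈ Ici t
    · rw [indicator_of_mem hx, abs_abs]
    · rw [indicator_of_notMem hx, abs_zero]; exact abs_nonneg c
  have h1 := h.remove.abs_primitive_le (hk.ite (.const 0) d) hbound x
  rw [h.primitive_remove_head hk, primitive.eq_1 _ (indicator _ _), setIntegral_indicator measurableSet_Ici,
    setIntegral_const, smul_eq_mul] at h1
  have h2 : h.remove.measure.real (Iio (min x d) ∩ Ici t) ≤ η := by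
    have : h.remove.measure.real (Ico t d) = g d - g t := by
      rw [h.remove.measureReal_Ico htd, h.remove_of_le le_rfl, h.remove_of_le htd]
    rw [← this] at ht
    have hsub : Iio (min x d) ∩ Ici t ⊆ Ico t d := fun y hy =>
      ⟨hy.2, lt_of_lt_of_le hy.1 (min_le_right _ _)⟩
    exact (measureReal_mono hsub).trans ht
  -- The jump term of `lift` drops out because `σ` and `ρ` agree beyond `d`; only an integral over a
  -- set of measure at most `η` remains.
  have e : h.lift σ x - h.lift ρ x = h.remove.primitive (σ + (-1 : ℝ) • ρ) x := by
    have e1 : h.lift σ x - h.lift ρ x = h.lift (σ + (-1 : ℝ) • ρ) x := by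
      rw [h.lift_add hσ (hρ.smul _), h.lift_smul]
      simp only [Pi.add_apply, Pi.smul_apply, smul_eq_mul]
      ring
    rw [e1, lift, Pi.add_apply, Pi.smul_apply, smul_eq_mul]
    split_ifs with hx
    · ring
    · simp [htail x (not_le.1 hx)]
  rw [e]
  calc |h.remove.primitive (σ + (-1 : ℝ) • ρ) x| ≤ η * |c| :=
        h1.trans (mul_le_mul_of_nonneg_right h2 (abs_nonneg c))
    _ ≤ η * (|c| + 1) := mul_le_mul_of_nonneg_left (by linarith) hηpos.le
    _ = ε := div_mul_cancel₀ _ (by positivity)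

/-- As `d` is the first discontinuity, the reduced iterated primitives are divided powers up to `d`.
Cutting one off after `d` kills the jump term of `lift`, and its primitive is the next divided power
stopped at `d`. -/
theorem head_mem_approximable (hcont : ∀ t < d, ContinuousAt g t)
    (ih : ∀ F : ℝ → ℝ, Continuous F → (fun x => F (h.remove x)) ∈ h.remove.approximable)
    {F : ℝ → ℝ} (hF : Continuous F) : (fun x => F (g (min x d))) ∈ g.approximable := by
  have hatom : ∀ t < d, h.remove.measure {t} = 0 := by
    intro t ht
    refine h.remove.measure_singleton_of_continuousAt ?_
    by_contra hc
    exact (h.discontinuities_remove_subset hc).1 (hcont t ht)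
  have heq : ∀ n, ∀ x ≤ d, h.remove.iteratedPrimitive n x =
      (g x - g g.left) ^ n / n.factorial := by
    intro n x hx
    rw [h.remove.iteratedPrimitive_eq hatom n hx, h.left_remove, h.remove_left,
      h.remove_of_le hx]
  refine g.comp_mem_approximable (fun x => min x d) (fun n => ?_) hF
  cases n with
  | zero =>
    convert g.iteratedPrimitive_mem_approximable 0 using 1
    funext x
    simp [iteratedPrimitive]
  | succ n =>
    have h1 := h.lift_ite_mem_approximable hcont ih
      (F₁ := fun u => (u - g g.left) ^ n / n.factorial) (F₂ := fun _ => 0)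
      (by fun_prop) continuous_const
    convert h1 using 1
    have e : (fun x => if x ≤ d then (g x - g g.left) ^ n / n.factorial else 0) =
        fun x => if x ≤ d then h.remove.iteratedPrimitive n x else 0 := by
      funext x
      split_ifs with hx
      · rw [heq n x hx]
      · rfl
    funext x
    rw [e, lift, Pi.add_apply, h.primitive_remove_head
      (h.remove.boundedMeasurable_iteratedPrimitive n), Pi.smul_apply, smul_eq_mul,
      ← heq (n + 1) _ (min_le_right x d)]
    split_ifs <;> simp [iteratedPrimitive]

theorem exists_primitive_remove_tail_eq {F : ℝ → ℝ} (hF : Continuous F) :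
    ∃ F' : ℝ → ℝ, Continuous F' ∧
      h.remove.primitive (fun x => if x ≤ d then 0 else F (g x)) =
        fun x => if x ≤ d then 0 else F' (g x) := by
  have hσ := BoundedMeasurable.comp g hF
  obtain ⟨G, hG, hGeq⟩ := h.remove.exists_primitive_eq_comp hσ
  refine ⟨fun u => G (u - D) - G (h.remove d), by fun_prop, funext fun x => ?_⟩
  rw [h.primitive_remove_tail hσ]
  split_ifs with hx
  · rfl
  · rw [hGeq, hGeq, h.remove_of_lt (not_le.1 hx)]

/-- For `σ` vanishing up to `d`, `lift` acts as `P + D` and `P σ` is again such a function, where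
`P` is the reduced primitive; so `P + D` can be inverted by iteration. -/
theorem tail_mem_approximable (hcont : ∀ t < d, ContinuousAt g t)
    (ih : ∀ F : ℝ → ℝ, Continuous F → (fun x => F (h.remove x)) ∈ h.remove.approximable)
    {F : ℝ → ℝ} (hF : Continuous F) :
    (fun x => if x ≤ d then 0 else F (g x)) ∈ g.approximable := by
  set σ : Icc a b → ℝ := fun x => if x ≤ d then 0 else F (g x) with hσ
  have hD := h.pos
  have hit : ∀ k, ∃ F' : ℝ → ℝ, Continuous F' ∧
      h.remove.primitive^[k] σ = fun x => if x ≤ d then 0 else F' (g x) := by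
    intro k
    induction k with
    | zero => exact ⟨F, hF, rfl⟩
    | succ k ihk =>
      obtain ⟨F', hF', e⟩ := ihk
      rw [Function.iterate_succ_apply', e]
      exact h.exists_primitive_remove_tail_eq hF'
  have hlift : ∀ k, h.remove.primitive^[k + 1] σ + D • h.remove.primitive^[k] σ ∈
      g.approximable := by
    intro k
    obtain ⟨F', hF', e⟩ := hit k
    have h1 := h.lift_ite_mem_approximable hcont ih (F₁ := fun _ => 0) continuous_const hF'
    rw [Function.iterate_succ_apply', e]
    convert h1 using 1
    rw [lift]
    congr 2
    funext x
    split_ifs <;> rfl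
  -- Partial sums of the Neumann series: adding `(-1 / D) ^ m / D` times `hlift m` replaces the
  -- remainder of order `m` by that of order `m + 1`.
  have hpart : ∀ m : ℕ, σ - (-1 / D) ^ m • h.remove.primitive^[m] σ ∈ g.approximable := by
    intro m
    induction m with
    | zero => simp
    | succ m ihm =>
      have := Submodule.add_mem _ ihm (Submodule.smul_mem _ ((-1 / D) ^ m / D) (hlift m))
      convert this using 1
      funext x
      simp only [Pi.sub_apply, Pi.add_apply, Pi.smul_apply, smul_eq_mul, pow_succ]
      generalize (-1 / D) ^ m = r
      field_simp
      ring
  obtain ⟨C, hC⟩ := (BoundedMeasurable.ite (.const 0) (.comp g hF) d : BoundedMeasurable σ).2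
  have hC0 : 0 ≤ C := (abs_nonneg _).trans (hC g.left)
  have hb : ∀ m x, |h.remove.primitive^[m] σ x| ≤ (C • h.remove.iteratedPrimitive m) x := by
    intro m
    induction m with
    | zero => intro x; simpa [iteratedPrimitive] using hC x
    | succ m ihm =>
      intro x
      rw [Function.iterate_succ_apply', iteratedPrimitive, ← primitive_smul]
      exact h.remove.abs_primitive_le
        ((h.remove.boundedMeasurable_iteratedPrimitive m).smul C) ihm x
  set M := h.remove h.remove.right - h.remove h.remove.left with hM
  have hlim := (FloorSemiring.tendsto_pow_div_factorial_atTop (M / D)).const_mul C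
  rw [mul_zero] at hlim
  refine uniformClosure.of_forall_approx fun ε hε => ?_
  obtain ⟨m, hm⟩ := (hlim.eventually (gt_mem_nhds hε)).exists
  refine ⟨_, hpart m, fun x => ?_⟩
  rw [Pi.sub_apply, sub_sub_cancel, Pi.smul_apply, smul_eq_mul, abs_mul, abs_pow, abs_div, abs_neg,
    abs_one, abs_of_pos hD]
  have h1 : h.remove.iteratedPrimitive m x ≤ M ^ m / m.factorial := by
    refine (h.remove.iteratedPrimitive_le m x).trans ?_
    have := h.remove.mono (h.remove.left_le x)
    have := h.remove.mono (h.remove.le_right x)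
    gcongr
    linarith
  calc (1 / D) ^ m * |h.remove.primitive^[m] σ x|
      ≤ (1 / D) ^ m * (C * (M ^ m / m.factorial)) := by
        refine mul_le_mul_of_nonneg_left ((hb m x).trans ?_) (by positivity)
        exact mul_le_mul_of_nonneg_left h1 hC0
    _ = C * ((M / D) ^ m / m.factorial) := by
        rw [div_pow, div_pow, one_pow]; ring
    _ ≤ ε := hm.le

theorem comp_mem_approximable (hcont : ∀ t < d, ContinuousAt g t)
    (ih : ∀ F : ℝ → ℝ, Continuous F → (fun x => F (h.remove x)) ∈ h.remove.approximable)
    {F : ℝ → ℝ} (hF : Continuous F) : (fun x => F (g x)) ∈ g.approximable := by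
  have h1 := Submodule.add_mem _ (h.head_mem_approximable hcont ih hF)
    (h.tail_mem_approximable hcont ih (F := fun u => F u - F (g d)) (by fun_prop))
  convert h1 using 1
  funext x
  simp only [Pi.add_apply]
  split_ifs with hx
  · rw [min_eq_left hx, add_zero]
  · rw [min_eq_right (not_le.1 hx).le, add_sub_cancel]

end IsJump

theorem comp_mem_approximable_of_finite (g : Derivator a b) (hg : g.discontinuities.Finite)
    {F : ℝ → ℝ} (hF : Continuous F) : (fun x => F (g x)) ∈ g.approximable := by
  induction hn : g.discontinuities.ncard using Nat.strong_induction_on generalizing g F with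
  | _ n ih =>
    rcases g.discontinuities.eq_empty_or_nonempty with he | hne
    · exact g.comp_mem_approximable_of_continuous he hF
    · obtain ⟨d, hd, hmin⟩ := exists_min_image g.discontinuities id hg hne
      obtain ⟨D, h⟩ := g.exists_isJump hd
      have hsub := h.discontinuities_remove_subset
      refine h.comp_mem_approximable (fun t ht => ?_) (fun F hF => ?_) hF
      · by_contra hc
        exact absurd (hmin t hc) (not_le.2 ht)
      · refine ih _ ?_ h.remove (hg.subset (hsub.trans sdiff_subset)) hF rfl
        rw [← hn]
        exact ncard_lt_ncard (hsub.trans_ssubset (sdiff_singleton_ssubset.2 hd)) hg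

/-! ### Return to `g`-polynomials with coefficients in `𝕜` -/

theorem monomial_left (g : Derivator a b) (n : ℕ) (x : Icc a b) :
    g.monomial g.left n x = n.factorial * g.iteratedPrimitive n x := by
  induction n generalizing x with
  | zero => simp [monomial, iteratedPrimitive]
  | succ n ih =>
    simp only [monomial, iteratedPrimitive, primitive]
    rw [if_pos (g.left_le x), ← g.Iio_eq_Ico_left, Nat.factorial_succ]
    simp only [ih]
    rw [integral_const_mul]
    push_cast
    ring

theorem exists_polynomials_coe_eq (g : Derivator a b) (𝕜 : Type*) [RCLike 𝕜] {p : Icc a b → ℝ}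
    (hp : p ∈ Submodule.span ℝ (range g.iteratedPrimitive)) :
    ∃ P ∈ g.polynomials 𝕜, ∀ x, P x = (p x : 𝕜) := by
  induction hp using Submodule.span_induction with
  | mem p hp =>
    obtain ⟨n, rfl⟩ := hp
    refine ⟨((n.factorial : 𝕜)⁻¹) • g.ucMonomial 𝕜 g.left n,
      Submodule.smul_mem _ _ (Submodule.subset_span ⟨g.left, n, rfl⟩), fun x => ?_⟩
    change (n.factorial : 𝕜)⁻¹ * (g.monomial g.left n x : 𝕜) = _
    rw [monomial_left, RCLike.ofReal_mul, RCLike.ofReal_natCast,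
      inv_mul_cancel_left₀ (Nat.cast_ne_zero.2 n.factorial_ne_zero)]
  | zero => exact ⟨0, Submodule.zero_mem _, fun x => RCLike.ofReal_zero.symm⟩
  | add p q _ _ hp hq =>
    obtain ⟨P, hP, hPe⟩ := hp
    obtain ⟨Q, hQ, hQe⟩ := hq
    refine ⟨P + Q, Submodule.add_mem _ hP hQ, fun x => ?_⟩
    rw [Pi.add_apply, RCLike.ofReal_add, ← hPe, ← hQe]
    rfl
  | smul c p _ hp =>
    obtain ⟨P, hP, hPe⟩ := hp
    refine ⟨(c : 𝕜) • P, Submodule.smul_mem _ _ hP, fun x => ?_⟩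
    rw [Pi.smul_apply, smul_eq_mul, RCLike.ofReal_mul, ← hPe]
    rfl

theorem mem_approximable_of_uniformlyContinuous (g : Derivator a b)
    (hg : g.discontinuities.Finite) {f : Icc a b → ℝ} (hf : g.UniformlyContinuous f) :
    f ∈ g.approximable := by
  obtain ⟨F, hF, e⟩ := exists_continuous_comp_eq (u := g) hf
  rw [funext e]
  exact g.comp_mem_approximable_of_finite hg hF

end Derivator

theorem mainTheorem1 {𝕜 : Type*} [RCLike 𝕜] {a b : ℝ} (g : Derivator a b)
    (hg : g.discontinuities.Finite) :
    Dense (g.polynomials 𝕜 : Set (g.UC 𝕜)) := by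
  intro f
  refine Metric.mem_closure_iff.2 fun ε hε => ?_
  have hre : g.UniformlyContinuous fun x => RCLike.re (f x) := by
    intro ε hε
    obtain ⟨δ, hδ, H⟩ := f.2 ε hε
    refine ⟨δ, hδ, fun x y hxy => ?_⟩
    rw [← map_sub]
    exact (RCLike.abs_re_le_norm _).trans_lt (H x y hxy)
  have him : g.UniformlyContinuous fun x => RCLike.im (f x) := by
    intro ε hε
    obtain ⟨δ, hδ, H⟩ := f.2 ε hε
    refine ⟨δ, hδ, fun x y hxy => ?_⟩
    rw [← map_sub]
    exact (RCLike.abs_im_le_norm _).trans_lt (H x y hxy)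
  obtain ⟨p, hp, hpe⟩ := g.mem_approximable_of_uniformlyContinuous hg hre (ε / 4) (by positivity)
  obtain ⟨q, hq, hqe⟩ := g.mem_approximable_of_uniformlyContinuous hg him (ε / 4) (by positivity)
  obtain ⟨P, hP, hPe⟩ := g.exists_polynomials_coe_eq 𝕜 hp
  obtain ⟨Q, hQ, hQe⟩ := g.exists_polynomials_coe_eq 𝕜 hq
  refine ⟨P + (RCLike.I : 𝕜) • Q,
    Submodule.add_mem _ hP (Submodule.smul_mem _ _ hQ), ?_⟩
  rw [dist_eq_norm]
  refine (Derivator.UC.norm_le_of_forall _ (C := ε / 2) fun x => ?_).trans_lt (by linarith)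
  have e : (f - (P + (RCLike.I : 𝕜) • Q)) x =
      ((RCLike.re (f x) - p x : ℝ) : 𝕜) + ((RCLike.im (f x) - q x : ℝ) : 𝕜) * RCLike.I := by
    change f x - (P x + RCLike.I * Q x) = _
    rw [hPe, hQe]
    nth_rw 1 [← RCLike.re_add_im (f x)]
    push_cast
    ring
  rw [e]
  refine (norm_add_le _ _).trans ?_
  rw [norm_mul, RCLike.norm_ofReal, RCLike.norm_ofReal]
  -- Only an inequality, since `RCLike.I` is `0` when `𝕜` is real.
  have hI : ‖(RCLike.I : 𝕜)‖ ≤ 1 := by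
    rcases RCLike.I_mul_I_ax (K := 𝕜) with h0 | h0
    · rw [h0, norm_zero]; exact zero_le_one
    · have : ‖(RCLike.I : 𝕜)‖ * ‖(RCLike.I : 𝕜)‖ = 1 := by
        rw [← norm_mul, h0, norm_neg, norm_one]
      nlinarith [norm_nonneg (RCLike.I : 𝕜)]
  nlinarith [hpe x, hqe x, abs_nonneg (RCLike.im (f x) - q x)]
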